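/- Let $p$ be a prime and $S$ a scheme. An algebraic space over $S$ is an fppf sheaf of sets $F$ on $\mathrm{Sch}/S$ whose diagonal is representable by schemes and which admits an atlas, i.e. a surjective étale map $\varphi: h_U\to F$ (representable by schemes) from an $S$-scheme $U$. A scheme has characteristic $p$ if $p=0$ in its structure sheaf; $F$ has characteristic $p$ if it is nonempty (has a point with values in a nonempty scheme) and admits an atlas $h_U\to F$ with $U$ of characteristic $p$. Let $AP_{S,p}$ be the category of algebraic spaces over $S$ of characteristic $p$, with morphisms over $S$. For a scheme $U$ of characteristic $p$ let $\Phi_U:U\to U$ be the absolute Frobenius (identity on the space, $g\mapsto g^p$ on functions). Since $\Phi_U$ need not be a morphism over $S$, write $F^{\mathrm{abs}}$ for $F$ regarded as a sheaf on the category of all schemes, $F^{\mathrm{abs}}(T)=\{(s,x): s:T\to S,\ x\in F(T\xrightarrow{s}S)\}$; this is functorial in $F$. An atlas $\varphi:h_U\to F$ induces $\varphi^{\mathrm{abs}}:h_U\to F^{\mathrm{abs}}$. For an atlas $\varphi : h_U\to F$ with $U$ of characteristic $p$, an endomorphism $\Psi$ of $F^{\mathrm{abs}}$ is called the algebraic Frobenius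 of $F$ with respect to $\varphi$ if $\Psi\circ\varphi^{\mathrm{abs}}=\varphi^{\mathrm{abs}}\circ h(\Phi_U)$. It is called an algebraic Frobenius of $F$ if it is one with respect to some such atlas. An endomorphism $\psi:F\to F$ over $S$ is called an algebraic Frobenius over $S$ if there is an atlas $\varphi:h_U\to F$ with $U$ of characteristic $p$, such that $\Phi_U$ is a morphism over $S$ and $\psi\circ\varphi=\varphi\circ h(\Phi_U)$. Proposition. 1. For every $F$ in $AP_{S,p}$ and every atlas $\varphi:h_U\to F$ with $U$ of characteristic $p$ there is exactly one algebraic Frobenius of $F$ with respect to $\varphi$. 2. For every morphism $f:F\to G$ in $AP_{S,p}$ and arbitrary algebraic Frobenius morphisms $\Psi_F$ of $F$ and $\Psi_G$ of $G$ (with respect to any atlases of characteristic $p$), $f^{\mathrm{abs}}\circ\Psi_F=\Psi_G\circ f^{\mathrm{abs}}$. 3. Consequently the algebraic Frobenius is a self-map of the functor $F\mapsto F^{\mathrm{abs}}$ on $AP_{S,p}$: there is a unique natural transformation $\eta$ from this functor to itself such that, for every $F$, $\eta_F$ is the one and only algebraic Frobenius of $F$. 4. For every morphism $f:F\to G$ in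 $AP_{S,p}$ and arbitrary algebraic Frobenius morphisms $\psi_F:F\to F$ and $\psi_G:G\to G$ over $S$, $f\circ\psi_F=\psi_G\circ f$. 5. If $\Phi_U$ is a morphism over $S$ for every $S$-scheme $U$ of characteristic $p$ (for example if $S=\operatorname{Spec}\mathbb Z$ or $S=\operatorname{Spec}\mathbb F_p$), then the algebraic Frobenius is a self-map of the identity functor of $AP_{S,p}$: there is a unique natural transformation $\eta:\mathrm{id}\to\mathrm{id}$ such that, for every $F$, $\eta_F$ is the one and only algebraic Frobenius of $F$ over $S$. -/

import Mathlib

open CategoryTheory Opposite AlgebraicGeometry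

universe u

/-! ## Schemes of characteristic `p` and their absolute Frobenius -/

/-- The scheme `X` has characteristic `p`: `p` is zero in the structure sheaf `𝒪_X`
(that is, `X` is an `𝔽_p`-scheme). -/
def SchemeHasChar (p : ℕ) (X : Scheme.{u}) : Prop :=
  ∀ V : X.Opens, (p : Γ(X, V)) = 0

/-- The `p`-th power map of a commutative ring in which the prime `p` is zero
(the zero ring is allowed). -/
def powerRingHom (p : ℕ) [hp : Fact p.Prime] (R : Type*) [CommRing R] (h : (p : R) = 0) :
    R →+* R where
  toFun a := a ^ p
  map_one' := one_pow p
  map_mul' a b := mul_pow a b p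
  map_zero' := zero_pow hp.out.ne_zero
  map_add' a b := by
    rcases subsingleton_or_nontrivial R with hR | hR
    · exact Subsingleton.elim _ _
    · have : CharP R p := (CharP.charP_iff_prime_eq_zero hp.out).mpr h
      exact add_pow_char a b p

/-- The identity of the underlying space with `g ↦ g ^ p` on sections. -/
noncomputable def frobeniusPresheafedSpace (p : ℕ) [Fact p.Prime] (X : Scheme.{u})
    (h : SchemeHasChar p X) : X.toPresheafedSpace ⟶ X.toPresheafedSpace where
  base := 𝟙 _
  c :=
    { app := fun V => CommRingCat.ofHom (powerRingHom p Γ(X, V.unop) (h V.unop))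
      naturality := by
        intro V W i
        ext a
        exact (map_pow (X.presheaf.map i).hom a p).symm }

/-- The absolute Frobenius `Φ_X : X ⟶ X` of a scheme of characteristic `p`: the identity on the
underlying space and `g ↦ g ^ p` on the structure sheaf. -/
noncomputable def absoluteFrobenius (p : ℕ) [hp : Fact p.Prime] (X : Scheme.{u})
    (h : SchemeHasChar p X) : X ⟶ X where
  toLRSHom' :=
    { toHom := frobeniusPresheafedSpace p X h
      prop := fun x => by
        constructor
        intro t ht
        obtain ⟨V, hx, s, rfl⟩ := X.presheaf.exists_germ_eq t
        have e := PresheafedSpace.stalkMap_germ_apply (frobeniusPresheafedSpace p X h) V x hx s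
        have e' : X.presheaf.germ V x hx (s ^ p) = (X.presheaf.germ V x hx s) ^ p :=
          map_pow (X.presheaf.germ V x hx).hom s p
        have key : IsUnit ((X.presheaf.germ V x hx s) ^ p) := by
          rw [← e']
          exact e ▸ ht
        exact (isUnit_pow_iff hp.out.ne_zero).mp key }

theorem absoluteFrobenius_base_apply (p : ℕ) [Fact p.Prime] (X : Scheme.{u})
    (h : SchemeHasChar p X) (x : X) : absoluteFrobenius p X h x = x := rfl

theorem absoluteFrobenius_app_apply (p : ℕ) [Fact p.Prime] (X : Scheme.{u})
    (h : SchemeHasChar p X) (V : X.Opens) (a : Γ(X, V)) :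
    (absoluteFrobenius p X h).app V a = a ^ p := rfl

/-! ## Algebraic spaces over `S` -/

/-- Presheaves of sets on the category of schemes over `S`. -/
abbrev PresheafOver (S : Scheme.{u}) := (Over S)ᵒᵖ ⥤ Type u

/-- A morphism of presheaves on `Sch/S` is surjective étale: it is representable by schemes and
each of its base changes to a scheme is a surjective étale morphism of schemes. -/
def IsSurjectiveEtale {S : Scheme.{u}} {F G : PresheafOver S} (φ : F ⟶ G) : Prop :=
  ((@Etale ⊓ @Surjective : MorphismProperty Scheme.{u}).inverseImage (Over.forget S)).presheaf φ

/-- Algebraic spaces over `S`: fppf sheaves on `Sch/S` whose diagonal is representable by schemes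
and which admit a surjective étale map from a scheme over `S`. -/
structure IsAlgebraicSpace {S : Scheme.{u}} (F : PresheafOver S) : Prop where
  isSheaf : Presieve.IsSheaf (Scheme.fppfTopology.over S) F
  representable_diag : (yoneda : Over S ⥤ PresheafOver S).relativelyRepresentable (Limits.diag F)
  exists_atlas : ∃ (U : Over S) (φ : yoneda.obj U ⟶ F), IsSurjectiveEtale φ

/-- `φ : h_U ⟶ F` is an étale atlas of `F` by a scheme `U` of characteristic `p`. -/
structure IsCharAtlas (p : ℕ) {S : Scheme.{u}} {F : PresheafOver S} {U : Over S}
    (φ : yoneda.obj U ⟶ F) : Prop where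
  hasChar : SchemeHasChar p U.left
  isSurjectiveEtale : IsSurjectiveEtale φ

/-- `F` is an algebraic space over `S` of characteristic `p`: it is nonempty and it has an étale
atlas by a scheme of characteristic `p`. -/
structure IsAlgebraicSpaceOfChar (p : ℕ) {S : Scheme.{u}} (F : PresheafOver S) : Prop where
  isAlgebraicSpace : IsAlgebraicSpace F
  nonempty : ∃ T : Over S, Nonempty T.left ∧ Nonempty (F.obj (op T))
  exists_atlas : ∃ (U : Over S) (φ : yoneda.obj U ⟶ F), IsCharAtlas p φ

/-- The category of algebraic spaces of characteristic `p` over `S`; morphisms are morphisms of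
sheaves on `Sch/S`. -/
abbrev AlgebraicSpaceOfChar (p : ℕ) (S : Scheme.{u}) :=
  ObjectProperty.FullSubcategory (fun F : PresheafOver S => IsAlgebraicSpaceOfChar p F)

/-! ## The underlying absolute space

The absolute Frobenius of an `S`-scheme is in general not a morphism over `S`, so the Frobenius of
an algebraic space `F` over `S` is an endomorphism of `F` regarded as a space without its
structure map to `S`. -/

/-- Two points over a scheme agree if their structure maps agree and the points agree along the
identity. -/
theorem absolutePoint_ext {S : Scheme.{u}} (F : PresheafOver S) {T : Scheme.{u}} {s t : T ⟶ S}
    (x : F.obj (op (Over.mk s))) (y : F.obj (op (Over.mk t))) (h : s = t)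
    (h' : x = F.map (Over.homMk (𝟙 T) (by simp [h]) : Over.mk s ⟶ Over.mk t).op y) :
    (⟨s, x⟩ : Σ s : T ⟶ S, F.obj (op (Over.mk s))) = ⟨t, y⟩ := by
  subst h
  have e : (Over.homMk (𝟙 T) (by simp) : Over.mk s ⟶ Over.mk s) = 𝟙 _ := rfl
  rw [e] at h'
  simp at h'
  rw [h']

/-- The restriction of a `T`-valued point of `F` along `g : T' ⟶ T`. -/
def restrictPoint {S : Scheme.{u}} (F : PresheafOver S) {T T' : Scheme.{u}} (g : T' ⟶ T)
    (x : Σ s : T ⟶ S, F.obj (op (Over.mk s))) : Σ s : T' ⟶ S, F.obj (op (Over.mk s)) :=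
  ⟨g ≫ x.1, F.map (Over.homMk g : Over.mk (g ≫ x.1) ⟶ Over.mk x.1).op x.2⟩

theorem restrictPoint_id {S : Scheme.{u}} (F : PresheafOver S) {T : Scheme.{u}}
    (x : Σ s : T ⟶ S, F.obj (op (Over.mk s))) : restrictPoint F (𝟙 T) x = x :=
  absolutePoint_ext F _ _ (Category.id_comp _) rfl

theorem restrictPoint_comp {S : Scheme.{u}} (F : PresheafOver S) {T T' T'' : Scheme.{u}}
    (g' : T'' ⟶ T') (g : T' ⟶ T) (x : Σ s : T ⟶ S, F.obj (op (Over.mk s))) :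
    restrictPoint F (g' ≫ g) x = restrictPoint F g' (restrictPoint F g x) := by
  obtain ⟨s, y⟩ := x
  refine absolutePoint_ext F (F.map (Over.homMk (g' ≫ g)).op y)
    (F.map (Over.homMk g' : Over.mk (g' ≫ g ≫ s) ⟶ Over.mk (g ≫ s)).op
      (F.map (Over.homMk g : Over.mk (g ≫ s) ⟶ Over.mk s).op y))
    (Category.assoc _ _ _) ?_
  rw [← Functor.map_comp_apply, ← Functor.map_comp_apply, ← op_comp, ← op_comp]
  congr 3

/-- `F` regarded as a presheaf on the category of all schemes: a `T`-valued point is a morphism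
`s : T ⟶ S` together with a point of `F` on the `S`-scheme `(T, s)`. -/
def absoluteSpace {S : Scheme.{u}} (F : PresheafOver S) : Scheme.{u}ᵒᵖ ⥤ Type u where
  obj T := Σ s : T.unop ⟶ S, F.obj (op (Over.mk s))
  map g := ↾(restrictPoint F g.unop)
  map_id _ := ConcreteCategory.hom_ext _ _ fun x => restrictPoint_id F x
  map_comp g g' := ConcreteCategory.hom_ext _ _ fun x => restrictPoint_comp F g'.unop g.unop x

/-- A morphism over `S` induces a morphism of absolute spaces. -/
def absoluteMap {S : Scheme.{u}} {F G : PresheafOver S} (f : F ⟶ G) :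
    absoluteSpace F ⟶ absoluteSpace G where
  app T := ↾fun (x : Σ s : T.unop ⟶ S, F.obj (op (Over.mk s))) =>
    (⟨x.1, f.app _ x.2⟩ : Σ s : T.unop ⟶ S, G.obj (op (Over.mk s)))
  naturality T T' g := ConcreteCategory.hom_ext _ _
    fun (x : Σ s : T.unop ⟶ S, F.obj (op (Over.mk s))) =>
      congrArg (Sigma.mk (g.unop ≫ x.1)) (NatTrans.naturality_apply f
        (Over.homMk g.unop : Over.mk (g.unop ≫ x.1) ⟶ Over.mk x.1).op x.2)

/-- The functor that regards an algebraic space over `S` of characteristic `p` as an absolute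
space. -/
def absoluteFunctor (p : ℕ) (S : Scheme.{u}) :
    AlgebraicSpaceOfChar p S ⥤ (Scheme.{u}ᵒᵖ ⥤ Type u) where
  obj F := absoluteSpace F.obj
  map f := absoluteMap f.hom

/-- The morphism from the scheme `U` to the absolute space of `F` given by `φ : h_U ⟶ F`. -/
def absoluteAtlas {S : Scheme.{u}} {F : PresheafOver S} {U : Over S} (φ : yoneda.obj U ⟶ F) :
    yoneda.obj U.left ⟶ absoluteSpace F where
  app T := ↾fun (g : T.unop ⟶ U.left) =>
    (⟨g ≫ U.hom, φ.app (op (Over.mk (g ≫ U.hom))) (Over.homMk g)⟩ :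
      Σ s : T.unop ⟶ S, F.obj (op (Over.mk s)))
  naturality T T' g := ConcreteCategory.hom_ext _ _ fun (x : T.unop ⟶ U.left) => by
    refine absolutePoint_ext F
      (φ.app (op (Over.mk ((g.unop ≫ x) ≫ U.hom))) (Over.homMk (g.unop ≫ x)))
      (F.map (Over.homMk g.unop : Over.mk (g.unop ≫ x ≫ U.hom) ⟶ Over.mk (x ≫ U.hom)).op
        (φ.app (op (Over.mk (x ≫ U.hom))) (Over.homMk x)))
      (Category.assoc _ _ _) ?_
    rw [← NatTrans.naturality_apply, ← NatTrans.naturality_apply]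
    congr 1

/-! ## Algebraic Frobenius morphisms -/

/-- `Ψ` is the algebraic Frobenius of `F` with respect to the atlas `φ : h_U ⟶ F` of
characteristic `p`: `Ψ ∘ φ = φ ∘ h(Φ_U)`. -/
def IsFrobeniusWithRespectTo (p : ℕ) [Fact p.Prime] {S : Scheme.{u}} {F : PresheafOver S}
    {U : Over S} (φ : yoneda.obj U ⟶ F) (hφ : IsCharAtlas p φ)
    (Ψ : absoluteSpace F ⟶ absoluteSpace F) : Prop :=
  absoluteAtlas φ ≫ Ψ = yoneda.map (absoluteFrobenius p U.left hφ.hasChar) ≫ absoluteAtlas φ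

/-- `Ψ` is an algebraic Frobenius of `F`, with respect to some atlas of characteristic `p`. -/
def IsAlgebraicFrobenius (p : ℕ) [Fact p.Prime] {S : Scheme.{u}} (F : PresheafOver S)
    (Ψ : absoluteSpace F ⟶ absoluteSpace F) : Prop :=
  ∃ (U : Over S) (φ : yoneda.obj U ⟶ F) (hφ : IsCharAtlas p φ), IsFrobeniusWithRespectTo p φ hφ Ψ

/-- `ψ : F ⟶ F` is an algebraic Frobenius of `F` in the category of algebraic spaces over `S`: for
some atlas `φ : h_U ⟶ F` of characteristic `p` for which the absolute Frobenius of `U` is a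
morphism `Φ` over `S`, one has `ψ ∘ φ = φ ∘ h(Φ)`. -/
def IsAlgebraicFrobeniusOver (p : ℕ) [Fact p.Prime] {S : Scheme.{u}} (F : PresheafOver S)
    (ψ : F ⟶ F) : Prop :=
  ∃ (U : Over S) (φ : yoneda.obj U ⟶ F) (hφ : IsCharAtlas p φ) (Φ : U ⟶ U),
    Φ.left = absoluteFrobenius p U.left hφ.hasChar ∧ φ ≫ ψ = yoneda.map Φ ≫ φ

/-! ## Characteristic `p` and naturality of the absolute Frobenius -/

/-! The Frobenius of `F` is described without an atlas: restrict a `T`-point along `Φ_T`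
(`spaceFrobenius`). This makes sense because any `T` carrying a point of `F` has characteristic `p`:
étale-locally the point lifts to an atlas `U`, and `p = 0` pulls back along morphisms and descends
along flat surjections. Since absolute Frobenius commutes with all scheme morphisms
(`absoluteFrobenius_comp`), the construction is natural in `T` and in `F` and is a Frobenius for
every atlas.

Uniqueness holds because an atlas is an epimorphism towards sheaves (`absoluteAtlas_hom_ext`), so
Frobenius morphisms for all atlases coincide. The statements over `S` reduce to the absolute ones
because `absoluteMap` is faithful; only existence over `S` needs `Φ_T` to respect the structure
maps. -/

theorem SchemeHasChar.of_hom {p : ℕ} {X Y : Scheme.{u}} (f : Y ⟶ X) (h : SchemeHasChar p X) :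
    SchemeHasChar p Y := fun V => by
  have e := congrArg (f.appLE ⊤ V le_top).hom (h ⊤)
  rwa [map_natCast, map_zero] at e

/-- Flat local homomorphisms are faithfully flat, hence injective, so `p = 0` descends on stalks;
surjectivity reaches every stalk of `X`. -/
theorem SchemeHasChar.of_flat_surjective {p : ℕ} {X Y : Scheme.{u}} (f : Y ⟶ X) [Flat f]
    [Surjective f] (h : SchemeHasChar p Y) : SchemeHasChar p X := fun V => by
  refine TopCat.Presheaf.section_ext X.sheaf V _ _ fun x hx => ?_
  obtain ⟨y, rfl⟩ := f.surjective x
  have hy : ((p : ℕ) : Y.presheaf.stalk y) = 0 := by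
    have e := congrArg (Y.presheaf.germ ⊤ y trivial).hom (h ⊤)
    rwa [map_natCast, map_zero] at e
  have hf : (f.stalkMap y).hom.FaithfullyFlat := by
    algebraize [(f.stalkMap y).hom]
    exact @Module.FaithfullyFlat.of_flat_of_isLocalHom _ _ _ _ _ _ _
      (Flat.stalkMap f y) (f.toLRSHom.prop y)
  change (X.presheaf.germ V (f y) hx).hom _ = (X.presheaf.germ V (f y) hx).hom _
  rw [map_natCast, map_zero]
  apply hf.injective
  rw [map_natCast, map_zero]
  exact hy

theorem absoluteFrobenius_comp (p : ℕ) [Fact p.Prime] {X Y : Scheme.{u}} (f : Y ⟶ X)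
    (hY : SchemeHasChar p Y) (hX : SchemeHasChar p X) :
    absoluteFrobenius p Y hY ≫ f = f ≫ absoluteFrobenius p X hX := by
  refine Scheme.Hom.ext rfl fun V => ?_
  ext a
  change Y.presheaf.map (𝟙 _) ((f.app V a) ^ p) = f.app V (a ^ p)
  rw [CategoryTheory.Functor.map_id]
  exact (map_pow (f.app V).hom a p).symm

/-! ## Points of an algebraic space and étale covers -/

variable {S : Scheme.{u}} {F G : PresheafOver S}

/-- The structure maps agree because flat surjections are epimorphisms; the points then agree
because `F` is separated for the fppf cover `g`. -/
theorem restrictPoint_injective (hF : Presieve.IsSheaf (Scheme.fppfTopology.over S) F)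
    {T T' : Scheme.{u}} (g : T' ⟶ T) [Etale g] [Surjective g] :
    Function.Injective (restrictPoint F g) := by
  rintro ⟨s, x⟩ ⟨t, y⟩ h
  have := Flat.epi_of_flat_of_surjective g
  obtain rfl : s = t := (cancel_epi g).1 (congrArg Sigma.fst h)
  have e : F.map (Over.homMk g : Over.mk (g ≫ s) ⟶ Over.mk s).op x =
      F.map (Over.homMk g : Over.mk (g ≫ s) ⟶ Over.mk s).op y := eq_of_heq (Sigma.mk.inj h).2
  congr 1
  have hc := Precoverage.generate_mem_toGrothendieck
    (Scheme.Hom.singleton_mem_fppfPrecoverage g)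
  refine (hF.isSeparated _ (Scheme.fppfTopology.overEquiv_symm_mem_over (Over.mk s) _ hc)).ext ?_
  intro W w hw
  rw [Sieve.overEquiv_symm_iff] at hw
  obtain ⟨_, a, _, ⟨⟩, ha⟩ := hw
  -- Each arrow of the covering sieve factors through `g` over `S`, so agreement along `g` suffices.
  have ha' : w = (Over.homMk a (by
      have := Over.w w
      simp at this ⊢
      rw [← this, ← ha, Category.assoc]) : W ⟶ Over.mk (g ≫ s)) ≫ (Over.homMk g : Over.mk (g ≫ s) ⟶ Over.mk s) := by
    ext1
    exact ha.symm
  rw [ha', op_comp, Functor.map_comp_apply, Functor.map_comp_apply, e]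

theorem absoluteAtlas_yoneda_map_comp {U V : Over S} (a : V ⟶ U) (φ : yoneda.obj U ⟶ F) :
    absoluteAtlas (yoneda.map a ≫ φ) = yoneda.map a.left ≫ absoluteAtlas φ := by
  ext T (u : T.unop ⟶ V.left)
  refine absolutePoint_ext F
    (φ.app (op (Over.mk (u ≫ V.hom))) ((Over.homMk u : Over.mk (u ≫ V.hom) ⟶ V) ≫ a))
    (φ.app (op (Over.mk ((u ≫ a.left) ≫ U.hom))) (Over.homMk (u ≫ a.left))) (by simp) ?_
  rw [← NatTrans.naturality_apply]
  congr 1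

theorem absoluteAtlas_app_apply {T : Scheme.{u}} {U : Over S} (φ : yoneda.obj U ⟶ F)
    (g : T ⟶ U.left) :
    (absoluteAtlas φ).app (op T) g =
      (⟨g ≫ U.hom, φ.app (op (Over.mk (g ≫ U.hom))) (Over.homMk g)⟩ :
        Σ s : T ⟶ S, F.obj (op (Over.mk s))) := rfl

/-- The Yoneda lemma for absolute points. -/
theorem absoluteAtlas_yonedaEquiv_symm_app_id {T : Scheme.{u}} {s : T ⟶ S}
    (x : F.obj (op (Over.mk s))) :
    (absoluteAtlas (yonedaEquiv.symm x)).app (op T) (𝟙 T) =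
      (⟨s, x⟩ : Σ s : T ⟶ S, F.obj (op (Over.mk s))) := by
  refine (absoluteAtlas_app_apply (yonedaEquiv.symm x) (𝟙 T)).trans ?_
  refine absolutePoint_ext F _ _ (Category.id_comp s) ?_
  rfl

theorem restrictPoint_absoluteAtlas {U V Z : Over S} (φ : yoneda.obj U ⟶ F) (ξ : yoneda.obj V ⟶ F)
    (a : Z ⟶ U) (b : Z ⟶ V) (w : yoneda.map a ≫ φ = yoneda.map b ≫ ξ) :
    restrictPoint F b.left ((absoluteAtlas ξ).app (op V.left) (𝟙 V.left)) =
      (absoluteAtlas φ).app (op Z.left) a.left := by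
  have hu := congrArg absoluteAtlas w
  rw [absoluteAtlas_yoneda_map_comp, absoluteAtlas_yoneda_map_comp] at hu
  have e := ConcreteCategory.congr_hom (NatTrans.congr_app hu (op Z.left)) (𝟙 Z.left)
  change (absoluteAtlas φ).app (op Z.left) (𝟙 Z.left ≫ a.left) =
    (absoluteAtlas ξ).app (op Z.left) (𝟙 Z.left ≫ b.left) at e
  have n := NatTrans.naturality_apply (absoluteAtlas ξ) b.left.op (𝟙 V.left)
  change (absoluteAtlas ξ).app (op Z.left) (b.left ≫ 𝟙 V.left) = restrictPoint F b.left _ at n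
  rw [Category.id_comp, Category.id_comp] at e
  rw [Category.comp_id] at n
  exact n.symm.trans e.symm

/-- `T'` is the fibre product of `φ` with the map `h_T ⟶ F` classifying `x`; it is a scheme, étale
and surjective over `T`. -/
theorem IsSurjectiveEtale.exists_lift {U : Over S} {φ : yoneda.obj U ⟶ F}
    (hφ : IsSurjectiveEtale φ) {T : Scheme.{u}} (x : Σ s : T ⟶ S, F.obj (op (Over.mk s))) :
    ∃ (T' : Scheme.{u}) (g : T' ⟶ T) (u : T' ⟶ U.left), Etale g ∧ Surjective g ∧
      restrictPoint F g x = (absoluteAtlas φ).app (op T') u := by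
  obtain ⟨s, x⟩ := x
  have hrep := MorphismProperty.relative.rep hφ
  obtain ⟨h₁, h₂⟩ := MorphismProperty.relative.property_snd hφ (yonedaEquiv.symm x)
  refine ⟨_, (hrep.snd (yonedaEquiv.symm x)).left, (hrep.fst' (yonedaEquiv.symm x)).left, h₁, h₂,
    ?_⟩
  rw [← absoluteAtlas_yonedaEquiv_symm_app_id x]
  refine restrictPoint_absoluteAtlas φ (yonedaEquiv.symm x) _ _ ?_
  rw [Functor.relativelyRepresentable.map_fst']
  exact hrep.w _

theorem IsCharAtlas.hasChar_of_point {p : ℕ} {U : Over S} {φ : yoneda.obj U ⟶ F}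
    (hφ : IsCharAtlas p φ) {T : Scheme.{u}} (x : Σ s : T ⟶ S, F.obj (op (Over.mk s))) :
    SchemeHasChar p T := by
  obtain ⟨T', g, u, _, _, -⟩ := hφ.isSurjectiveEtale.exists_lift x
  exact (hφ.hasChar.of_hom u).of_flat_surjective g

theorem IsAlgebraicSpaceOfChar.hasChar_of_point {p : ℕ} (hF : IsAlgebraicSpaceOfChar p F)
    {T : Scheme.{u}} (x : Σ s : T ⟶ S, F.obj (op (Over.mk s))) : SchemeHasChar p T := by
  obtain ⟨U, φ, hφ⟩ := hF.exists_atlas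
  exact hφ.hasChar_of_point x

/-- An atlas is an epimorphism towards absolute spaces of sheaves. -/
theorem IsSurjectiveEtale.absoluteAtlas_hom_ext {U : Over S} {φ : yoneda.obj U ⟶ F}
    (hφ : IsSurjectiveEtale φ) (hG : Presieve.IsSheaf (Scheme.fppfTopology.over S) G)
    {α β : absoluteSpace F ⟶ absoluteSpace G}
    (h : absoluteAtlas φ ≫ α = absoluteAtlas φ ≫ β) : α = β := by
  ext T x
  obtain ⟨T', g, u, _, _, hx⟩ := hφ.exists_lift x
  -- After restriction to `T'` the point comes from `U`, where the two maps agree by hypothesis.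
  apply restrictPoint_injective hG g
  have ha := NatTrans.naturality_apply α g.op x
  have hb := NatTrans.naturality_apply β g.op x
  have hu := ConcreteCategory.congr_hom (NatTrans.congr_app h (op T')) u
  refine ha.symm.trans (Eq.trans ?_ hb)
  change α.app (op T') (restrictPoint F g x) = β.app (op T') (restrictPoint F g x)
  rw [hx]
  exact hu

/-! ## The canonical Frobenius of an algebraic space -/

/-- The Frobenius of an algebraic space of characteristic `p`: a point over `T` is sent to its
restriction along the absolute Frobenius of `T`. -/
noncomputable def spaceFrobenius (p : ℕ) [Fact p.Prime] (hF : IsAlgebraicSpaceOfChar p F) :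
    absoluteSpace F ⟶ absoluteSpace F where
  app T := ↾fun (x : Σ s : T.unop ⟶ S, F.obj (op (Over.mk s))) =>
    restrictPoint F (absoluteFrobenius p T.unop (hF.hasChar_of_point x)) x
  naturality T T' g := ConcreteCategory.hom_ext _ _
    fun (x : Σ s : T.unop ⟶ S, F.obj (op (Over.mk s))) => by
      change restrictPoint F (absoluteFrobenius p T'.unop _) (restrictPoint F g.unop x) =
        restrictPoint F g.unop (restrictPoint F (absoluteFrobenius p T.unop _) x)
      rw [← restrictPoint_comp, ← restrictPoint_comp,
        absoluteFrobenius_comp p g.unop _ (hF.hasChar_of_point x)]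

theorem spaceFrobenius_comp_absoluteMap (p : ℕ) [Fact p.Prime] (hF : IsAlgebraicSpaceOfChar p F)
    (hG : IsAlgebraicSpaceOfChar p G) (f : F ⟶ G) :
    spaceFrobenius p hF ≫ absoluteMap f = absoluteMap f ≫ spaceFrobenius p hG := by
  ext T x
  -- The Frobenius is itself a restriction map, so this is naturality of `f` along `Φ_T`.
  exact NatTrans.naturality_apply (absoluteMap f)
    (absoluteFrobenius p T.unop (hF.hasChar_of_point x)).op x

theorem isFrobeniusWithRespectTo_spaceFrobenius (p : ℕ) [Fact p.Prime]
    (hF : IsAlgebraicSpaceOfChar p F) {U : Over S} (φ : yoneda.obj U ⟶ F)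
    (hφ : IsCharAtlas p φ) : IsFrobeniusWithRespectTo p φ hφ (spaceFrobenius p hF) := by
  ext T (u : T.unop ⟶ U.left)
  have hT := hφ.hasChar.of_hom u
  have h := NatTrans.naturality_apply (absoluteAtlas φ) (absoluteFrobenius p T.unop hT).op u
  refine h.symm.trans (congrArg ((absoluteAtlas φ).app T) ?_)
  exact absoluteFrobenius_comp p u hT hφ.hasChar

/-- Independence of the atlas: the canonical Frobenius satisfies the equation for whichever atlas
`Ψ` uses, and that atlas is epimorphic. -/
theorem isAlgebraicFrobenius_iff (p : ℕ) [Fact p.Prime] (hF : IsAlgebraicSpaceOfChar p F)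
    (Ψ : absoluteSpace F ⟶ absoluteSpace F) :
    IsAlgebraicFrobenius p F Ψ ↔ Ψ = spaceFrobenius p hF := by
  constructor
  · rintro ⟨U, φ, hφ, h⟩
    exact hφ.isSurjectiveEtale.absoluteAtlas_hom_ext hF.isAlgebraicSpace.isSheaf
      (h.trans (isFrobeniusWithRespectTo_spaceFrobenius p hF φ hφ).symm)
  · rintro rfl
    obtain ⟨U, φ, hφ⟩ := hF.exists_atlas
    exact ⟨U, φ, hφ, isFrobeniusWithRespectTo_spaceFrobenius p hF φ hφ⟩

/-! ## Frobenius morphisms over the base -/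

theorem absoluteMap_injective : Function.Injective (absoluteMap : (F ⟶ G) → _) := by
  intro f g h
  ext T x
  have e := ConcreteCategory.congr_hom (NatTrans.congr_app h (op T.unop.left))
    (⟨T.unop.hom, x⟩ : Σ s : T.unop.left ⟶ S, F.obj (op (Over.mk s)))
  exact eq_of_heq (Sigma.mk.inj e).2

theorem absoluteAtlas_comp_absoluteMap {U : Over S} (φ : yoneda.obj U ⟶ F) (f : F ⟶ G) :
    absoluteAtlas φ ≫ absoluteMap f = absoluteAtlas (φ ≫ f) := rfl

theorem IsAlgebraicFrobeniusOver.absoluteMap_eq {p : ℕ} [Fact p.Prime]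
    (hF : IsAlgebraicSpaceOfChar p F) {ψ : F ⟶ F} (h : IsAlgebraicFrobeniusOver p F ψ) :
    absoluteMap ψ = spaceFrobenius p hF := by
  obtain ⟨U, φ, hφ, Φ, hΦ, e⟩ := h
  refine (isAlgebraicFrobenius_iff p hF _).1 ⟨U, φ, hφ, ?_⟩
  rw [IsFrobeniusWithRespectTo, absoluteAtlas_comp_absoluteMap, e, absoluteAtlas_yoneda_map_comp,
    hΦ]

theorem IsAlgebraicFrobeniusOver.comp_eq_comp {p : ℕ} [Fact p.Prime]
    (hF : IsAlgebraicSpaceOfChar p F) (hG : IsAlgebraicSpaceOfChar p G) {ψF : F ⟶ F} {ψG : G ⟶ G}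
    (h : IsAlgebraicFrobeniusOver p F ψF) (h' : IsAlgebraicFrobeniusOver p G ψG) (f : F ⟶ G) :
    ψF ≫ f = f ≫ ψG := by
  apply absoluteMap_injective
  change absoluteMap ψF ≫ absoluteMap f = absoluteMap f ≫ absoluteMap ψG
  rw [h.absoluteMap_eq hF, h'.absoluteMap_eq hG, spaceFrobenius_comp_absoluteMap]

/-- If the absolute Frobenius of every `S`-scheme of characteristic `p` is a morphism over `S`, then
the Frobenius of an algebraic space over `S` is a morphism over `S`. -/
noncomputable def spaceFrobeniusOver (p : ℕ) [Fact p.Prime] (hF : IsAlgebraicSpaceOfChar p F)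
    (hS : ∀ (U : Over S) (hU : SchemeHasChar p U.left),
      absoluteFrobenius p U.left hU ≫ U.hom = U.hom) : F ⟶ F where
  app T := ↾fun (x : F.obj T) =>
    have hT : SchemeHasChar p T.unop.left := hF.hasChar_of_point ⟨T.unop.hom, x⟩
    F.map (Over.homMk (absoluteFrobenius p T.unop.left hT) (hS T.unop hT) : T.unop ⟶ T.unop).op x
  naturality T T' g := ConcreteCategory.hom_ext _ _ fun (x : F.obj T) => by
    have hT : SchemeHasChar p T.unop.left := hF.hasChar_of_point ⟨T.unop.hom, x⟩
    have hT' := hT.of_hom g.unop.left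
    change F.map (Over.homMk (absoluteFrobenius p T'.unop.left hT') (hS _ hT') : T'.unop ⟶ T'.unop).op
        (F.map g x) =
      F.map g (F.map (Over.homMk (absoluteFrobenius p T.unop.left hT) (hS _ hT) : T.unop ⟶ T.unop).op x)
    rw [← Functor.map_comp_apply, ← Functor.map_comp_apply]
    congr 3
    apply Quiver.Hom.unop_inj
    ext1
    exact absoluteFrobenius_comp p g.unop.left hT' hT

theorem isAlgebraicFrobeniusOver_iff (p : ℕ) [Fact p.Prime] (hF : IsAlgebraicSpaceOfChar p F)
    (hS : ∀ (U : Over S) (hU : SchemeHasChar p U.left),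
      absoluteFrobenius p U.left hU ≫ U.hom = U.hom) (ψ : F ⟶ F) :
    IsAlgebraicFrobeniusOver p F ψ ↔ ψ = spaceFrobeniusOver p hF hS := by
  have key : IsAlgebraicFrobeniusOver p F (spaceFrobeniusOver p hF hS) := by
    obtain ⟨U, φ, hφ⟩ := hF.exists_atlas
    refine ⟨U, φ, hφ, Over.homMk (absoluteFrobenius p U.left hφ.hasChar) (hS U _), rfl, ?_⟩
    ext T (u : T.unop ⟶ U)
    have hT := hφ.hasChar.of_hom u.left
    have n := NatTrans.naturality_apply φ
      (Over.homMk (absoluteFrobenius p T.unop.left hT) (hS T.unop hT) : T.unop ⟶ T.unop).op u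
    refine n.symm.trans (congrArg (φ.app T) ?_)
    apply Over.OverMorphism.ext
    exact absoluteFrobenius_comp p u.left hT hφ.hasChar
  -- Uniqueness is inherited: both morphisms induce the canonical absolute Frobenius.
  refine ⟨fun h => absoluteMap_injective ?_, fun h => h ▸ key⟩
  rw [h.absoluteMap_eq hF, key.absoluteMap_eq hF]

theorem mainTheorem9 (p : ℕ) [Fact p.Prime] (S : Scheme.{u}) :
    -- with respect to each atlas there is exactly one algebraic Frobenius
    (∀ (F : AlgebraicSpaceOfChar p S) (U : Over S) (φ : yoneda.obj U ⟶ F.obj)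
      (hφ : IsCharAtlas p φ),
      ∃! Ψ : absoluteSpace F.obj ⟶ absoluteSpace F.obj, IsFrobeniusWithRespectTo p φ hφ Ψ) ∧
    -- algebraic Frobenius morphisms, for arbitrary atlases, commute with every morphism
    (∀ (F G : AlgebraicSpaceOfChar p S) (f : F ⟶ G)
      (ΨF : absoluteSpace F.obj ⟶ absoluteSpace F.obj)
      (ΨG : absoluteSpace G.obj ⟶ absoluteSpace G.obj),
      IsAlgebraicFrobenius p F.obj ΨF → IsAlgebraicFrobenius p G.obj ΨG →
        ΨF ≫ absoluteMap f.hom = absoluteMap f.hom ≫ ΨG) ∧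
    -- so they form a self-map of the functor that forgets the structure map to `S`
    (∃! η : absoluteFunctor p S ⟶ absoluteFunctor p S,
      ∀ (F : AlgebraicSpaceOfChar p S) (Ψ : absoluteSpace F.obj ⟶ absoluteSpace F.obj),
        IsAlgebraicFrobenius p F.obj Ψ ↔ Ψ = η.app F) ∧
    -- the same within the category of algebraic spaces over `S`, for Frobenius morphisms over `S`
    (∀ (F G : AlgebraicSpaceOfChar p S) (f : F ⟶ G) (ψF : F ⟶ F) (ψG : G ⟶ G),
      IsAlgebraicFrobeniusOver p F.obj ψF.hom → IsAlgebraicFrobeniusOver p G.obj ψG.hom →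
        ψF ≫ f = f ≫ ψG) ∧
    -- a self-map of the identity functor, when absolute Frobenius morphisms are morphisms over `S`
    ((∀ (U : Over S) (hU : SchemeHasChar p U.left),
        absoluteFrobenius p U.left hU ≫ U.hom = U.hom) →
      ∃! η : 𝟭 (AlgebraicSpaceOfChar p S) ⟶ 𝟭 (AlgebraicSpaceOfChar p S),
        ∀ (F : AlgebraicSpaceOfChar p S) (ψ : F ⟶ F),
          IsAlgebraicFrobeniusOver p F.obj ψ.hom ↔ ψ = η.app F) := by
  refine ⟨fun F U φ hφ => ?_, fun F G f ΨF ΨG hF hG => ?_, ?_, fun F G f ψF ψG hF hG => ?_,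
    fun hS => ?_⟩
  · exact ⟨spaceFrobenius p F.property,
      isFrobeniusWithRespectTo_spaceFrobenius p F.property φ hφ,
      fun Ψ hΨ => (isAlgebraicFrobenius_iff p F.property Ψ).1 ⟨U, φ, hφ, hΨ⟩⟩
  · rw [(isAlgebraicFrobenius_iff p F.property ΨF).1 hF,
      (isAlgebraicFrobenius_iff p G.property ΨG).1 hG]
    exact spaceFrobenius_comp_absoluteMap p F.property G.property f.hom
  · refine ⟨{ app := fun F => spaceFrobenius p F.property, naturality := fun F G f =>
      (spaceFrobenius_comp_absoluteMap p F.property G.property f.hom).symm },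
      fun F => isAlgebraicFrobenius_iff p F.property, fun η hη => ?_⟩
    ext1
    funext F
    exact (isAlgebraicFrobenius_iff p F.property _).1 ((hη F _).2 rfl)
  · exact ObjectProperty.hom_ext _ (hF.comp_eq_comp F.property G.property hG f.hom)
  · have hiff (F : AlgebraicSpaceOfChar p S) (ψ : F ⟶ F) :
        IsAlgebraicFrobeniusOver p F.obj ψ.hom ↔
          ψ = ObjectProperty.homMk (spaceFrobeniusOver p F.property hS) :=
      (isAlgebraicFrobeniusOver_iff p F.property hS ψ.hom).trans
        ⟨fun h => ObjectProperty.hom_ext _ h, fun h => congrArg (fun ψ => ψ.hom) h⟩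
    refine ⟨{ app := fun F => ObjectProperty.homMk (spaceFrobeniusOver p F.property hS),
              naturality := fun F G f => ObjectProperty.hom_ext _ ?_ }, hiff, fun η hη => ?_⟩
    -- Naturality is the commutation of arbitrary Frobenius morphisms over `S`, applied to the
    -- canonical ones.
    · exact (((isAlgebraicFrobeniusOver_iff p F.property hS _).2 rfl).comp_eq_comp F.property
        G.property ((isAlgebraicFrobeniusOver_iff p G.property hS _).2 rfl) f.hom).symm
    · ext1
      funext F
      exact (hiff F _).1 ((hη F _).2 rfl)
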